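/- Let $P$ be a Borel probability distribution on $\mathbb{R}$ with compact support, let $\beta\in(0,1)$, and let $C:[0,\infty)\to[0,\infty)$ be increasing, strictly convex and continuously differentiable, with derivative $c=C'$ (one-sided at $0$) and inverse $c^{-1}$ defined on the range of $c$. For an initial inventory $x^1\ge 0$ consider the problem $$\text{maximize}_{y^1,y^2,\ldots}\quad \mathbb{E}\Bigl[\sum_{t=1}^{\infty}\beta^{t-1}\bigl(p^t(x^t-x^{t+1})-C(x^{t+1})\bigr)\Bigr]\quad\text{subject to}\quad x^{t+1}=y^t(x^t,p^t)\in[0,x^t]\ \text{ for all } t\ge 1 \text{ (almost surely)},$$ where the prices $p^1,p^2,\ldots$ are independent and identically distributed according to $P$, and the maximum is over the policies $(y^t)_{t\ge1}$, that is, sequences of decision rules $y^t$ for which $p\mapsto y^t(x,p)$ is measurable for every $x\ge 0$, and for which the total reward is integrable, so that the objective is well defined. Then the stationary policy that at inventory $x$ and price $p$ sells down to $$y(x,p)=c^{-1}\Bigl(\bigl(\beta\,\mathbb{E}_{q\sim P}\bigl[(q-p)_+\bigr]-(1-\beta)p\bigr)_{[c(0),c(x)]}\Bigr),$$ where $(z)_{[a,b]}$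 is the projection of $z$ onto $[a,b]$ and $(z)_+=\max\{z,0\}$, satisfies $y(x,p)\in[0,x]$ for all $x\ge0$ and $p\in\mathbb{R}$, and is optimal: for every $x^1\ge 0$ it is admissible and attains the maximum of this problem. -/

import Mathlib

open MeasureTheory

namespace ROSP

noncomputable section

/-- The marginal storage cost `c`: the derivative of `C` on `[0, ∞)` (one-sided at `0`). -/
def marginalCost (C : ℝ → ℝ) : ℝ → ℝ :=
  derivWithin C (Set.Ici 0)

/-- The standing assumptions on a storage cost `C : [0, ∞) → [0, ∞)`: increasing, strictly convex
and continuously differentiable. Only the values of `C` on `[0, ∞)` matter. -/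
structure IsStorageCost (C : ℝ → ℝ) : Prop where
  nonneg : ∀ x, 0 ≤ x → 0 ≤ C x
  monotoneOn : MonotoneOn C (Set.Ici 0)
  strictConvexOn : StrictConvexOn ℝ (Set.Ici 0) C
  contDiffOn : ContDiffOn ℝ 1 C (Set.Ici 0)

/-- The joint law `P × P × ⋯` of the independent, identically distributed prices. Stages are
indexed from `0`. -/
def priceLaw (P : Measure ℝ) [IsProbabilityMeasure P] : Measure (ℕ → ℝ) :=
  Measure.infinitePi fun _ : ℕ => P

/-- A policy: `y t x p` is the next inventory level chosen at stage `t`, at current inventory `x`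
and current price `p`. -/
abbrev Policy : Type := ℕ → ℝ → ℝ → ℝ

/-- The inventory levels reached from initial inventory `x₁` under the policy `y` along the price
path `p`. -/
def inventory (y : Policy) (x₁ : ℝ) (p : ℕ → ℝ) : ℕ → ℝ
  | 0 => x₁
  | t + 1 => y t (inventory y x₁ p t) (p t)

/-- The discounted reward earned at stage `t`: revenue minus storage cost. -/
def discountedReward (C : ℝ → ℝ) (β : ℝ) (y : Policy) (x₁ : ℝ) (p : ℕ → ℝ) (t : ℕ) : ℝ :=
  β ^ t * (p t * (inventory y x₁ p t - inventory y x₁ p (t + 1)) - C (inventory y x₁ p (t + 1)))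

/-- The total discounted reward along the price path `p`. -/
def totalReward (C : ℝ → ℝ) (β : ℝ) (y : Policy) (x₁ : ℝ) (p : ℕ → ℝ) : ℝ :=
  ∑' t, discountedReward C β y x₁ p t

/-- The expected total discounted reward. -/
def objective (P : Measure ℝ) [IsProbabilityMeasure P] (C : ℝ → ℝ) (β : ℝ) (x₁ : ℝ)
    (y : Policy) : ℝ :=
  ∫ p, totalReward C β y x₁ p ∂(priceLaw P)

/-- The policies that compete in the problem started at `x₁`: each decision rule is measurable in
the price, almost surely every new inventory level lies between zero and the current one, and the
objective is well defined (measurability of each `y t x` alone does not make the total reward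
measurable, so this has to be required separately). -/
structure IsAdmissible (P : Measure ℝ) [IsProbabilityMeasure P] (C : ℝ → ℝ) (β : ℝ) (x₁ : ℝ)
    (y : Policy) : Prop where
  measurable : ∀ t x, 0 ≤ x → Measurable (y t x)
  feasible : ∀ᵐ p ∂(priceLaw P), ∀ t,
    inventory y x₁ p (t + 1) ∈ Set.Icc 0 (inventory y x₁ p t)
  summable : ∀ᵐ p ∂(priceLaw P), Summable (discountedReward C β y x₁ p)
  integrable : Integrable (totalReward C β y x₁) (priceLaw P)

/-- `y` is optimal for the problem started at `x₁`: it is admissible and no admissible policy has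
a larger objective. -/
def IsOptimal (P : Measure ℝ) [IsProbabilityMeasure P] (C : ℝ → ℝ) (β : ℝ) (x₁ : ℝ)
    (y : Policy) : Prop :=
  IsAdmissible P C β x₁ y ∧ IsMaxOn (objective P C β x₁) {y' | IsAdmissible P C β x₁ y'} y

/-- Projection of `z` onto `[a, b]`, for `a ≤ b`. -/
def proj (a b z : ℝ) : ℝ :=
  max a (min z b)

/-- The inverse `c⁻¹` of the marginal cost `c : [0, ∞) → ℝ`, on the range of `c`. -/
def marginalCostInv (C : ℝ → ℝ) : ℝ → ℝ :=
  Function.invFunOn (marginalCost C) (Set.Ici 0)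

/-- The closed-form decision rule
`y(x, p) = c⁻¹ (proj_[c(0), c(x)] (β E[(q - p)₊] - (1 - β) p))`, with `q` distributed as `P`. -/
def sellDownTo (P : Measure ℝ) (C : ℝ → ℝ) (β : ℝ) (x p : ℝ) : ℝ :=
  marginalCostInv C (proj (marginalCost C 0) (marginalCost C x)
    (β * (∫ q, max (q - p) 0 ∂P) - (1 - β) * p))

end

end ROSP

/-! The problem decouples over inventory levels. Since `C x - C 0` is the integral of `c` over `[0,
x]`, the unit at level `s` costs `c(s)` per stage kept, and selling it is a stopping problem. Its
critical price `w(s)` solves `g(w) = c(s)`, where `g`, the `holdingMargin`, is a strictly decreasing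
bijection of `ℝ`. Equivalently `β E[max(q, w)] = w + c(s)`: at price `w`, selling and keeping are
equally good. The unit is worth `E[max(q, w(s))]`, and integrating over levels gives
`valueFunction`, with `-C 0 / (1 - β)` for the unavoidable cost.

With this value `V`, moving from `x` to `x'` at price `p` yields, up to that constant, `∫ w` over
the kept levels `[0, x']` plus `∫ p` over the sold levels `[x', x]`. This is at most `∫ max(p, w)`
over `[0, x]`, with equality for `sellDownTo` because `w` is decreasing. Averaging over `p` returns
`V(x)` by Fubini, which is the Bellman equation.

For verification, `IsAdmissible.integral_objective_tail` conditions on the first price. Iterating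
the Bellman relations `n` times leaves an error `β ^ n * K`, with `K` uniform over policies and
bounded inventories. -/

namespace ROSP

/-! ### Marginal cost and its inverse -/

section StorageCost

variable {C : ℝ → ℝ}

theorem IsStorageCost.hasDerivWithinAt (hC : IsStorageCost C) {x : ℝ} (hx : 0 ≤ x) :
    HasDerivWithinAt C (marginalCost C x) (Set.Ici 0) x :=
  ((hC.contDiffOn.differentiableOn (by norm_num)) x hx).hasDerivWithinAt

theorem IsStorageCost.continuousOn_marginalCost (hC : IsStorageCost C) :
    ContinuousOn (marginalCost C) (Set.Ici 0) :=
  hC.contDiffOn.continuousOn_derivWithin (uniqueDiffOn_Ici 0) (by norm_num)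

theorem IsStorageCost.strictMonoOn_marginalCost (hC : IsStorageCost C) :
    StrictMonoOn (marginalCost C) (Set.Ici 0) := by
  intro x hx y hy hxy
  have h1 := hC.strictConvexOn.lt_slope_of_hasDerivWithinAt_Ioi hx hy hxy
    ((hC.hasDerivWithinAt hx).mono fun z hz => hx.trans (Set.mem_Ioi.1 hz).le)
  have hy0 : (0 : ℝ) < y := lt_of_le_of_lt hx hxy
  have h2 := hC.strictConvexOn.slope_lt_of_hasDerivWithinAt_Iio hx hy hxy
    ((hC.hasDerivWithinAt hy).hasDerivAt (Ici_mem_nhds hy0)).hasDerivWithinAt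
  exact h1.trans h2

theorem IsStorageCost.integral_marginalCost (hC : IsStorageCost C) {x : ℝ} (hx : 0 ≤ x) :
    ∫ s in (0 : ℝ)..x, marginalCost C s = C x - C 0 := by
  have hsub : Set.Icc 0 x ⊆ Set.Ici (0 : ℝ) := Set.Icc_subset_Ici_self
  refine intervalIntegral.integral_eq_sub_of_hasDerivAt_of_le hx
    (hC.contDiffOn.continuousOn.mono hsub)
    (fun s hs => (hC.hasDerivWithinAt hs.1.le).hasDerivAt (Ici_mem_nhds hs.1)) ?_
  refine ContinuousOn.intervalIntegrable ?_
  rw [Set.uIcc_of_le hx]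
  exact hC.continuousOn_marginalCost.mono hsub

theorem proj_mem_Icc {a b : ℝ} (hab : a ≤ b) (z : ℝ) : proj a b z ∈ Set.Icc a b :=
  ⟨le_max_left _ _, max_le hab (min_le_right _ _)⟩

theorem proj_mono (a b : ℝ) : Monotone (proj a b) :=
  fun _ _ h => max_le_max le_rfl (min_le_min h le_rfl)

/-- The inverse marginal cost inverts the marginal cost between `c 0` and `c x`. -/
theorem IsStorageCost.marginalCostInv_spec (hC : IsStorageCost C) {x z : ℝ} (hx : 0 ≤ x)
    (hz : z ∈ Set.Icc (marginalCost C 0) (marginalCost C x)) :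
    marginalCostInv C z ∈ Set.Icc 0 x ∧ marginalCost C (marginalCostInv C z) = z := by
  obtain ⟨a, ha, rfl⟩ := intermediate_value_Icc hx
    (hC.continuousOn_marginalCost.mono Set.Icc_subset_Ici_self) hz
  have : marginalCostInv C (marginalCost C a) = a :=
    hC.strictMonoOn_marginalCost.injOn.leftInvOn_invFunOn ha.1
  rw [this]
  exact ⟨ha, rfl⟩

end StorageCost

noncomputable section

/-- The function `g p = β E[(q - p)₊] - (1 - β) p`: the expected gain from carrying a unit to the
next stage at price `p`, where it is sold if the price exceeds `p`. -/
def holdingMargin (P : Measure ℝ) (β p : ℝ) : ℝ :=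
  β * (∫ q, max (q - p) 0 ∂P) - (1 - β) * p

/-- The price below which the unit at inventory level `s` is kept. -/
def criticalPrice (P : Measure ℝ) (C : ℝ → ℝ) (β s : ℝ) : ℝ :=
  Function.invFun (holdingMargin P β) (marginalCost C (max s 0))

/-- The value of the problem in closed form. -/
def valueFunction (P : Measure ℝ) (C : ℝ → ℝ) (β x : ℝ) : ℝ :=
  -C 0 / (1 - β) + ∫ s in (0 : ℝ)..x, ∫ q, max q (criticalPrice P C β s) ∂P

end

/-! ### The closed-form decision rule -/

section SellDownTo

variable {P : Measure ℝ} {C : ℝ → ℝ} {β : ℝ}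

theorem IsStorageCost.proj_mem (hC : IsStorageCost C) {x : ℝ} (hx : 0 ≤ x) (z : ℝ) :
    proj (marginalCost C 0) (marginalCost C x) z ∈
      Set.Icc (marginalCost C 0) (marginalCost C x) :=
  proj_mem_Icc (hC.strictMonoOn_marginalCost.monotoneOn Set.self_mem_Ici hx hx) z

theorem sellDownTo_mem_Icc (hC : IsStorageCost C) {x : ℝ} (hx : 0 ≤ x) (p : ℝ) :
    sellDownTo P C β x p ∈ Set.Icc 0 x :=
  (hC.marginalCostInv_spec hx (hC.proj_mem hx _)).1

theorem marginalCost_sellDownTo (hC : IsStorageCost C) {x : ℝ} (hx : 0 ≤ x) (p : ℝ) :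
    marginalCost C (sellDownTo P C β x p) =
      proj (marginalCost C 0) (marginalCost C x) (holdingMargin P β p) :=
  (hC.marginalCostInv_spec hx (hC.proj_mem hx _)).2

theorem monotoneOn_marginalCostInv (hC : IsStorageCost C) {x : ℝ} (hx : 0 ≤ x) :
    MonotoneOn (marginalCostInv C) (Set.Icc (marginalCost C 0) (marginalCost C x)) := by
  intro a ha b hb hab
  obtain ⟨ha', hca⟩ := hC.marginalCostInv_spec hx ha
  obtain ⟨hb', hcb⟩ := hC.marginalCostInv_spec hx hb
  rwa [← hC.strictMonoOn_marginalCost.le_iff_le ha'.1 hb'.1, hca, hcb]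

/-- Inventory enters the rule only through the upper end `c(x)` of the projection interval, and
lowering that end from `c(z)` to `c(x)` caps the projection at `c(x)`. Injectivity of `c` transfers
this to inventories. -/
theorem sellDownTo_eq_min (hC : IsStorageCost C) {x z : ℝ} (hx : 0 ≤ x) (hxz : x ≤ z) (p : ℝ) :
    sellDownTo P C β x p = min x (sellDownTo P C β z p) := by
  have hz := hx.trans hxz
  have hc := hC.strictMonoOn_marginalCost
  have hyx := sellDownTo_mem_Icc (P := P) (β := β) hC hx p
  have hyz := sellDownTo_mem_Icc (P := P) (β := β) hC hz p
  have h0x : marginalCost C 0 ≤ marginalCost C x := hc.monotoneOn Set.self_mem_Ici hx hx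
  have hxz' : marginalCost C x ≤ marginalCost C z := hc.monotoneOn hx hz hxz
  refine hc.injOn hyx.1 (le_min hx hyz.1) ?_
  rw [hc.monotoneOn.map_min hx hyz.1, marginalCost_sellDownTo hC hx,
    marginalCost_sellDownTo hC hz, proj, proj, min_max_distrib_left, min_eq_right h0x,
    min_left_comm, min_eq_left hxz']

end SellDownTo

/-! ### Holding margin and critical prices -/

section HoldingMargin

variable {P : Measure ℝ} [IsProbabilityMeasure P] {C : ℝ → ℝ} {β : ℝ}

theorem integrable_max_sub (hP : Integrable (fun q : ℝ => q) P) (p : ℝ) :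
    Integrable (fun q => max (q - p) 0) P :=
  (hP.sub (integrable_const p)).pos_part

theorem antitone_integral_max_sub (hP : Integrable (fun q : ℝ => q) P) :
    Antitone fun p : ℝ => ∫ q, max (q - p) 0 ∂P := fun a b hab =>
  integral_mono (integrable_max_sub hP b) (integrable_max_sub hP a)
    fun q => max_le_max (by linarith) le_rfl

theorem integral_max_sub_le_add (hP : Integrable (fun q : ℝ => q) P) {a b : ℝ} (hab : a ≤ b) :
    ∫ q, max (q - a) 0 ∂P ≤ (∫ q, max (q - b) 0 ∂P) + (b - a) := by
  have h : ∫ q, (max (q - b) 0 + (b - a)) ∂P = (∫ q, max (q - b) 0 ∂P) + (b - a) := by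
    rw [integral_add (integrable_max_sub hP b) (integrable_const _)]
    simp
  rw [← h]
  refine integral_mono (integrable_max_sub hP a)
    ((integrable_max_sub hP b).add (integrable_const _)) fun q => ?_
  exact max_le (by linarith [le_max_left (q - b) 0]) (by linarith [le_max_right (q - b) 0])

theorem strictAnti_holdingMargin (hP : Integrable (fun q : ℝ => q) P)
    (hβ : β ∈ Set.Ioo (0 : ℝ) 1) : StrictAnti (holdingMargin P β) := by
  intro a b hab
  have h1 := mul_le_mul_of_nonneg_left (antitone_integral_max_sub hP hab.le) hβ.1.le
  have h2 := mul_lt_mul_of_pos_left hab (sub_pos.2 hβ.2)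
  simp only [holdingMargin]
  simp only at h1
  linarith

theorem continuous_holdingMargin (hP : Integrable (fun q : ℝ => q) P) :
    Continuous (holdingMargin P β) := by
  have h : LipschitzWith 1 fun p : ℝ => ∫ q, max (q - p) 0 ∂P := by
    refine LipschitzWith.of_le_add fun a b => ?_
    rcases le_total a b with hab | hab
    · rw [dist_comm, Real.dist_eq, abs_of_nonneg (sub_nonneg.2 hab)]
      exact integral_max_sub_le_add hP hab
    · exact (antitone_integral_max_sub hP hab).trans (le_add_of_nonneg_right dist_nonneg)
  exact (continuous_const.mul h.continuous).sub (continuous_const.mul continuous_id)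

/-- The term `-(1 - β) p` drives both limits: the expectation is nonnegative, and for `p ≥ 0` it is
at most its value at `p = 0`. -/
theorem surjective_holdingMargin (hP : Integrable (fun q : ℝ => q) P)
    (hβ : β ∈ Set.Ioo (0 : ℝ) 1) : Function.Surjective (holdingMargin P β) := by
  have hβ1 : 0 < 1 - β := sub_pos.2 hβ.2
  refine (continuous_holdingMargin hP).surjective' ?_ ?_
  · refine Filter.tendsto_atTop_mono (f := fun p => (1 - β) * (-p)) (fun p => ?_)
      (Filter.tendsto_neg_atBot_atTop.const_mul_atTop hβ1)
    have : 0 ≤ ∫ q, max (q - p) 0 ∂P := integral_nonneg fun q => le_max_right _ _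
    simp only [holdingMargin]
    nlinarith [mul_nonneg hβ.1.le this]
  · have hlim : Filter.Tendsto
        (fun p : ℝ => β * (∫ q, max (q - 0) 0 ∂P) + (1 - β) * (-p)) Filter.atTop Filter.atBot :=
      Filter.tendsto_atBot_add_const_left _ _
        (Filter.tendsto_neg_atTop_atBot.const_mul_atBot hβ1)
    refine Filter.tendsto_atBot_mono' _ ?_ hlim
    filter_upwards [Filter.eventually_ge_atTop 0] with p hp
    have := mul_le_mul_of_nonneg_left (antitone_integral_max_sub hP hp) hβ.1.le
    simp only [holdingMargin]
    simp only at this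
    linarith

theorem holdingMargin_criticalPrice (hP : Integrable (fun q : ℝ => q) P)
    (hβ : β ∈ Set.Ioo (0 : ℝ) 1) {s : ℝ} (hs : 0 ≤ s) :
    holdingMargin P β (criticalPrice P C β s) = marginalCost C s := by
  rw [criticalPrice, Function.invFun_eq (surjective_holdingMargin hP hβ _), max_eq_left hs]

/-- The truncation `max s 0` makes this hold on all of `ℝ`, so that interval integrability comes
from monotonicity alone. -/
theorem antitone_criticalPrice (hP : Integrable (fun q : ℝ => q) P)
    (hβ : β ∈ Set.Ioo (0 : ℝ) 1) (hC : IsStorageCost C) : Antitone (criticalPrice P C β) := by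
  intro s t hst
  rw [← (strictAnti_holdingMargin hP hβ).le_iff_ge, criticalPrice, criticalPrice,
    Function.invFun_eq (surjective_holdingMargin hP hβ _),
    Function.invFun_eq (surjective_holdingMargin hP hβ _)]
  exact hC.strictMonoOn_marginalCost.monotoneOn (Set.mem_Ici.2 (le_max_right _ _))
    (Set.mem_Ici.2 (le_max_right _ _)) (max_le_max hst le_rfl)

theorem integrable_max_const (hP : Integrable (fun q : ℝ => q) P) (w : ℝ) :
    Integrable (fun q => max q w) P :=
  hP.sup (integrable_const w)

/-- The marginal form of the Bellman equation. -/
theorem mul_integral_max_criticalPrice (hP : Integrable (fun q : ℝ => q) P)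
    (hβ : β ∈ Set.Ioo (0 : ℝ) 1) {s : ℝ} (hs : 0 ≤ s) :
    β * (∫ q, max q (criticalPrice P C β s) ∂P) =
      criticalPrice P C β s + marginalCost C s := by
  rw [← holdingMargin_criticalPrice (C := C) hP hβ hs, holdingMargin]
  generalize criticalPrice P C β s = w
  have : ∫ q, max q w ∂P = (∫ q, max (q - w) 0 ∂P) + w := by
    have h : ∫ q, (max (q - w) 0 + w) ∂P = (∫ q, max (q - w) 0 ∂P) + w := by
      rw [integral_add (integrable_max_sub hP w) (integrable_const _)]
      simp
    rw [← h]
    refine integral_congr_ae (Filter.Eventually.of_forall fun q => ?_)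
    simp only [← max_add_add_right, sub_add_cancel, zero_add]
  rw [this]
  ring

theorem antitone_integral_max_criticalPrice (hP : Integrable (fun q : ℝ => q) P)
    (hβ : β ∈ Set.Ioo (0 : ℝ) 1) (hC : IsStorageCost C) :
    Antitone fun s => ∫ q, max q (criticalPrice P C β s) ∂P := fun _ _ hst =>
  integral_mono (integrable_max_const hP _) (integrable_max_const hP _)
    fun _ => max_le_max le_rfl (antitone_criticalPrice hP hβ hC hst)

/-! ### The Bellman equation for the closed-form value -/

theorem continuous_valueFunction (hP : Integrable (fun q : ℝ => q) P)
    (hβ : β ∈ Set.Ioo (0 : ℝ) 1) (hC : IsStorageCost C) : Continuous (valueFunction P C β) :=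
  continuous_const.add (intervalIntegral.continuous_primitive
    (fun _ _ => (antitone_integral_max_criticalPrice hP hβ hC).intervalIntegrable) 0)

/-- This integrates `mul_integral_max_criticalPrice` over the levels in `[0, x]`. The constant
survives because `-C 0 / (1 - β)` is the fixed point of `k ↦ β k - C 0`. -/
theorem mul_valueFunction_sub (hP : Integrable (fun q : ℝ => q) P)
    (hβ : β ∈ Set.Ioo (0 : ℝ) 1) (hC : IsStorageCost C) {x : ℝ} (hx : 0 ≤ x) :
    β * valueFunction P C β x - C x =
      -C 0 / (1 - β) + ∫ s in (0 : ℝ)..x, criticalPrice P C β s := by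
  have hc : IntervalIntegrable (marginalCost C) volume 0 x := by
    refine ContinuousOn.intervalIntegrable ?_
    rw [Set.uIcc_of_le hx]
    exact hC.continuousOn_marginalCost.mono Set.Icc_subset_Ici_self
  have h : β * ∫ s in (0 : ℝ)..x, ∫ q, max q (criticalPrice P C β s) ∂P =
      (∫ s in (0 : ℝ)..x, criticalPrice P C β s) + (C x - C 0) := by
    rw [← hC.integral_marginalCost hx, ← intervalIntegral.integral_const_mul,
      ← intervalIntegral.integral_add (antitone_criticalPrice hP hβ hC).intervalIntegrable hc]
    refine intervalIntegral.integral_congr fun s hs => ?_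
    rw [Set.uIcc_of_le hx] at hs
    exact mul_integral_max_criticalPrice hP hβ hs.1
  have hβ1 : 1 - β ≠ 0 := (sub_pos.2 hβ.2).ne'
  have h0 : β * (-C 0 / (1 - β)) - C 0 = -C 0 / (1 - β) := by
    field_simp
    ring
  rw [valueFunction, mul_add, h]
  linarith

theorem intervalIntegrable_max_criticalPrice (hP : Integrable (fun q : ℝ => q) P)
    (hβ : β ∈ Set.Ioo (0 : ℝ) 1) (hC : IsStorageCost C) (p a b : ℝ) :
    IntervalIntegrable (fun s => max p (criticalPrice P C β s)) volume a b :=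
  Antitone.intervalIntegrable fun _ _ h =>
    max_le_max le_rfl (antitone_criticalPrice hP hβ hC h)

theorem reward_add_valueFunction (hP : Integrable (fun q : ℝ => q) P)
    (hβ : β ∈ Set.Ioo (0 : ℝ) 1) (hC : IsStorageCost C) {x x' : ℝ} (hx' : 0 ≤ x') (p : ℝ) :
    p * (x - x') - C x' + β * valueFunction P C β x' =
      -C 0 / (1 - β) + ((∫ s in (0 : ℝ)..x', criticalPrice P C β s) + ∫ _ in x'..x, p) := by
  rw [intervalIntegral.integral_const, smul_eq_mul]
  linarith [mul_valueFunction_sub hP hβ hC hx']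

theorem reward_add_valueFunction_le (hP : Integrable (fun q : ℝ => q) P)
    (hβ : β ∈ Set.Ioo (0 : ℝ) 1) (hC : IsStorageCost C) {x x' : ℝ} (hx' : x' ∈ Set.Icc 0 x)
    (p : ℝ) :
    p * (x - x') - C x' + β * valueFunction P C β x' ≤
      -C 0 / (1 - β) + ∫ s in (0 : ℝ)..x, max p (criticalPrice P C β s) := by
  have hm := intervalIntegrable_max_criticalPrice hP hβ hC p
  rw [reward_add_valueFunction hP hβ hC hx'.1,
    ← intervalIntegral.integral_add_adjacent_intervals (hm 0 x') (hm x' x)]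
  gcongr
  · exact intervalIntegral.integral_mono_on hx'.1
      (antitone_criticalPrice hP hβ hC).intervalIntegrable (hm 0 x') fun s _ => le_max_right _ _
  · exact intervalIntegral.integral_mono_on hx'.2
      intervalIntegrable_const (hm x' x) fun s _ => le_max_left _ _

theorem antitone_sellDownTo (hP : Integrable (fun q : ℝ => q) P)
    (hβ : β ∈ Set.Ioo (0 : ℝ) 1) (hC : IsStorageCost C) {x : ℝ} (hx : 0 ≤ x) :
    Antitone (sellDownTo P C β x) := fun _ _ h =>
  monotoneOn_marginalCostInv hC hx (hC.proj_mem hx _) (hC.proj_mem hx _)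
    (proj_mono _ _ ((strictAnti_holdingMargin hP hβ).antitone h))

theorem reward_add_valueFunction_sellDownTo (hP : Integrable (fun q : ℝ => q) P)
    (hβ : β ∈ Set.Ioo (0 : ℝ) 1) (hC : IsStorageCost C) {x : ℝ} (hx : 0 ≤ x) (p : ℝ) :
    p * (x - sellDownTo P C β x p) - C (sellDownTo P C β x p) +
        β * valueFunction P C β (sellDownTo P C β x p) =
      -C 0 / (1 - β) + ∫ s in (0 : ℝ)..x, max p (criticalPrice P C β s) := by
  have hm := intervalIntegrable_max_criticalPrice hP hβ hC p
  have hy := sellDownTo_mem_Icc (P := P) (β := β) hC hx p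
  have hcy := marginalCost_sellDownTo (P := P) (β := β) hC hx p
  set y := sellDownTo P C β x p
  have hc := hC.strictMonoOn_marginalCost
  have hg := strictAnti_holdingMargin hP hβ
  rw [reward_add_valueFunction hP hβ hC hy.1,
    ← intervalIntegral.integral_add_adjacent_intervals (hm 0 y) (hm y x)]
  congr 2
  · refine intervalIntegral.integral_congr_ae (Filter.Eventually.of_forall fun s hs => ?_)
    rw [Set.uIoc_of_le hy.1] at hs
    refine (max_eq_right ?_).symm
    rw [← hg.le_iff_ge, holdingMargin_criticalPrice hP hβ hs.1.le]
    have hsy : marginalCost C s ≤ marginalCost C y := hc.monotoneOn hs.1.le hy.1 hs.2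
    rw [hcy, proj] at hsy
    -- The lower clip is ruled out by `0 < s`, the interval being open on the left, so `c(s) ≤
    -- g(p)`, that is, `p ≤ w(s)`.
    rcases le_max_iff.1 hsy with h | h
    · exact absurd h (hc Set.self_mem_Ici hs.1.le hs.1).not_ge
    · exact h.trans (min_le_left _ _)
  · refine intervalIntegral.integral_congr_ae (Filter.Eventually.of_forall fun s hs => ?_)
    rw [Set.uIoc_of_le hy.2] at hs
    have hs0 : 0 ≤ s := hy.1.trans hs.1.le
    refine (max_eq_left ?_).symm
    rw [← hg.le_iff_ge, holdingMargin_criticalPrice hP hβ hs0]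
    have hys : marginalCost C y < marginalCost C s := hc hy.1 hs0 hs.1
    have hsx : marginalCost C s ≤ marginalCost C x := hc.monotoneOn hs0 hx hs.2
    rw [hcy, proj] at hys
    -- Above `y` the upper clip is ruled out by `s ≤ x`, so `g(p) < c(s)` and the level is sold.
    rcases min_lt_iff.1 ((le_max_right _ _).trans_lt hys) with h | h
    · exact h.le
    · exact absurd h hsx.not_gt

theorem valueFunction_eq_integral (hP : Integrable (fun q : ℝ => q) P)
    (hβ : β ∈ Set.Ioo (0 : ℝ) 1) (hC : IsStorageCost C) {x : ℝ} (hx : 0 ≤ x) :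
    Integrable (fun p => -C 0 / (1 - β) + ∫ s in (0 : ℝ)..x, max p (criticalPrice P C β s)) P ∧
    valueFunction P C β x =
      ∫ p, (-C 0 / (1 - β) + ∫ s in (0 : ℝ)..x, max p (criticalPrice P C β s)) ∂P := by
  have hw : Integrable (criticalPrice P C β) (volume.restrict (Set.Ioc 0 x)) :=
    ((antitone_criticalPrice hP hβ hC).intervalIntegrable (a := 0) (b := x)).1
  have hint : Integrable (Function.uncurry fun p s => max p (criticalPrice P C β s))
      (P.prod (volume.restrict (Set.Ioc 0 x))) :=
    (hP.comp_fst _).sup (hw.comp_snd P)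
  have hint' : Integrable (fun p => ∫ s in (0 : ℝ)..x, max p (criticalPrice P C β s)) P := by
    simpa only [intervalIntegral.integral_of_le hx, Function.uncurry_apply_pair] using hint.integral_prod_left
  refine ⟨(integrable_const _).add hint', ?_⟩
  rw [integral_add (integrable_const _) hint', valueFunction]
  simp only [intervalIntegral.integral_of_le hx]
  rw [integral_integral_swap hint]
  simp

end HoldingMargin

end ROSP

namespace ROSP

/-! ### Splitting off the first price -/

section Paths

/-- The price path with first price `a` and later prices `q`. -/
def consPath (a : ℝ) (q : ℕ → ℝ) : ℕ → ℝ
  | 0 => a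
  | t + 1 => q t

theorem measurable_consPath : Measurable fun z : ℝ × (ℕ → ℝ) => consPath z.1 z.2 := by
  refine measurable_pi_lambda _ fun t => ?_
  cases t with
  | zero => exact measurable_fst
  | succ t => exact (measurable_pi_apply t).comp measurable_snd

instance (P : Measure ℝ) [IsProbabilityMeasure P] : IsProbabilityMeasure (priceLaw P) := by
  unfold priceLaw
  infer_instance

/-- Under the law of the price path, the first price is independent of the later ones, and these
have the same law as the whole path. -/
theorem measurePreserving_consPath (P : Measure ℝ) [IsProbabilityMeasure P] :
    MeasurePreserving (fun z : ℝ × (ℕ → ℝ) => consPath z.1 z.2) (P.prod (priceLaw P))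
      (priceLaw P) := by
  refine ⟨measurable_consPath, Measure.eq_infinitePi _ fun s t ht => ?_⟩
  classical
  -- A finite box pulls back to a condition on the first price, vacuous when `0 ∉ s`, times a box on
  -- the shifted coordinates.
  have hpre : (fun z : ℝ × (ℕ → ℝ) => consPath z.1 z.2) ⁻¹' Set.pi s t =
      (if 0 ∈ s then t 0 else Set.univ) ×ˢ
        Set.pi (s.preimage Nat.succ Nat.succ_injective.injOn) fun i => t (i + 1) := by
    ext ⟨a, q⟩
    simp only [Set.mem_preimage, Set.mem_pi, Finset.mem_coe, Set.mem_prod, Finset.mem_preimage]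
    constructor
    · intro h
      refine ⟨?_, fun i hi => h _ hi⟩
      split_ifs with h0
      · exact h 0 h0
      · trivial
    · rintro ⟨h0, h1⟩ i hi
      cases i with
      | zero => rwa [if_pos hi] at h0
      | succ i => exact h1 i hi
  rw [Measure.map_apply measurable_consPath (MeasurableSet.pi s.countable_toSet fun i _ => ht i),
    hpre, Measure.prod_prod, priceLaw, Measure.infinitePi_pi _ fun i _ => ht _]
  have hprod : ∏ i ∈ s.preimage Nat.succ Nat.succ_injective.injOn, P (t (i + 1)) =
      ∏ i ∈ s.erase 0, P (t i) := by
    rw [Finset.prod_preimage' Nat.succ s Nat.succ_injective.injOn fun i => P (t i)]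
    refine Finset.prod_congr (Finset.ext fun i => ?_) fun _ _ => rfl
    cases i <;> simp
  rw [hprod]
  split_ifs with h0
  · exact Finset.mul_prod_erase s (fun i => P (t i)) h0
  · rw [measure_univ, one_mul, Finset.erase_eq_of_notMem h0]

theorem ae_ae_consPath {P : Measure ℝ} [IsProbabilityMeasure P] {φ : (ℕ → ℝ) → Prop}
    (h : ∀ᵐ p ∂(priceLaw P), φ p) : ∀ᵐ a ∂P, ∀ᵐ q ∂(priceLaw P), φ (consPath a q) :=
  Measure.ae_ae_of_ae_prod ((measurePreserving_consPath P).quasiMeasurePreserving.ae h)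

/-- The policy `y` from the next stage on. -/
def Policy.tail (y : Policy) : Policy := fun t => y (t + 1)

variable {C : ℝ → ℝ} {β : ℝ} {y : Policy}

theorem inventory_consPath (x a : ℝ) (q : ℕ → ℝ) (t : ℕ) :
    inventory y x (consPath a q) (t + 1) = inventory y.tail (y 0 x a) q t := by
  induction t with
  | zero => rfl
  | succ t ih =>
    rw [inventory, ih]
    rfl

theorem discountedReward_consPath_zero (x a : ℝ) (q : ℕ → ℝ) :
    discountedReward C β y x (consPath a q) 0 = a * (x - y 0 x a) - C (y 0 x a) := by
  simp [discountedReward, inventory, consPath]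

theorem discountedReward_consPath_succ (x a : ℝ) (q : ℕ → ℝ) (t : ℕ) :
    discountedReward C β y x (consPath a q) (t + 1) =
      β * discountedReward C β y.tail (y 0 x a) q t := by
  simp only [discountedReward, inventory_consPath, pow_succ]
  simp only [consPath]
  ring

theorem totalReward_consPath {x a : ℝ} {q : ℕ → ℝ}
    (h : Summable (discountedReward C β y x (consPath a q))) :
    totalReward C β y x (consPath a q) =
      a * (x - y 0 x a) - C (y 0 x a) + β * totalReward C β y.tail (y 0 x a) q := by
  rw [totalReward, h.tsum_eq_zero_add, discountedReward_consPath_zero]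
  simp only [discountedReward_consPath_succ, tsum_mul_left, totalReward]

end Paths

/-! ### Conditioning an admissible policy on the first price -/

section Admissible

variable {P : Measure ℝ} [IsProbabilityMeasure P] {C : ℝ → ℝ} {β : ℝ} {y : Policy} {x : ℝ}

theorem IsAdmissible.ae_mem_Icc (h : IsAdmissible P C β x y) :
    ∀ᵐ a ∂P, y 0 x a ∈ Set.Icc 0 x := by
  filter_upwards [ae_ae_consPath h.feasible] with a ha
  obtain ⟨q, hq⟩ := ha.exists
  exact hq 0

/-- Fubini gives each almost sure property on almost every section. Integrability of the tail reward
follows by solving `totalReward_consPath` for it, which divides by `β`. -/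
theorem IsAdmissible.ae_tail (h : IsAdmissible P C β x y) (hβ : β ≠ 0) :
    ∀ᵐ a ∂P, 0 ≤ y 0 x a → IsAdmissible P C β (y 0 x a) y.tail := by
  filter_upwards [ae_ae_consPath h.feasible, ae_ae_consPath h.summable,
    ((measurePreserving_consPath P).integrable_comp_of_integrable h.integrable).prod_right_ae]
    with a hf hs hi _
  refine ⟨fun t z hz => h.measurable (t + 1) z hz, ?_, ?_, ?_⟩
  · filter_upwards [hf] with q hq t
    have := hq (t + 1)
    rwa [inventory_consPath, inventory_consPath] at this
  · filter_upwards [hs] with q hq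
    have := (summable_nat_add_iff 1).2 hq
    simp only [discountedReward_consPath_succ] at this
    exact (summable_mul_left_iff hβ).1 this
  · refine ((hi.sub (integrable_const (a * (x - y 0 x a) - C (y 0 x a)))).const_mul β⁻¹).congr ?_
    filter_upwards [hs] with q hq
    simp only [Pi.sub_apply, Function.comp_apply, totalReward_consPath hq]
    field_simp
    ring

/-- Conditioning on the first price. -/
theorem IsAdmissible.integral_objective_tail (h : IsAdmissible P C β x y) (hβ : β ≠ 0) :
    Integrable (fun a => a * (x - y 0 x a) - C (y 0 x a) +
      β * objective P C β (y 0 x a) y.tail) P ∧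
    objective P C β x y = ∫ a, (a * (x - y 0 x a) - C (y 0 x a) +
      β * objective P C β (y 0 x a) y.tail) ∂P := by
  have hmp := measurePreserving_consPath P
  have hint := hmp.integrable_comp_of_integrable h.integrable
  have hae : (fun a => ∫ q, totalReward C β y x (consPath a q) ∂(priceLaw P)) =ᵐ[P]
      fun a => a * (x - y 0 x a) - C (y 0 x a) + β * objective P C β (y 0 x a) y.tail := by
    filter_upwards [ae_ae_consPath h.summable, h.ae_mem_Icc, h.ae_tail hβ] with a hs hy ht
    have hi := (ht hy.1).integrable
    rw [integral_congr_ae (hs.mono fun q hq => totalReward_consPath hq),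
      integral_add (integrable_const _) (hi.const_mul β), integral_const_mul]
    simp [objective]
  -- Decision rules need not be jointly measurable, so measurability of the tail objective in `a` is
  -- inherited from Fubini through `hae`.
  refine ⟨hint.integral_prod_left.congr hae, ?_⟩
  rw [← integral_congr_ae hae, objective]
  have hmap := hmp.map_eq
  have hm : AEStronglyMeasurable (totalReward C β y x)
      ((P.prod (priceLaw P)).map fun z : ℝ × (ℕ → ℝ) => consPath z.1 z.2) := by
    rw [hmap]
    exact h.integrable.aestronglyMeasurable
  conv_lhs => rw [← hmap]
  rw [integral_map measurable_consPath.aemeasurable hm]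
  exact integral_prod _ hint

end Admissible

/-! ### Uniform bounds and admissibility of the rule -/

section Bounds

variable {P : Measure ℝ} [IsProbabilityMeasure P] {C : ℝ → ℝ} {β : ℝ} {y : Policy} {x M : ℝ}

theorem inventory_mem_Icc {p : ℕ → ℝ} (hx : 0 ≤ x)
    (h : ∀ t, inventory y x p (t + 1) ∈ Set.Icc 0 (inventory y x p t)) (t : ℕ) :
    inventory y x p t ∈ Set.Icc 0 x := by
  induction t with
  | zero => exact ⟨hx, le_rfl⟩
  | succ t ih => exact ⟨(h t).1, (h t).2.trans ih.2⟩

theorem abs_discountedReward_le (hβ : β ∈ Set.Ioo (0 : ℝ) 1) (hC : IsStorageCost C) (hx : 0 ≤ x)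
    {p : ℕ → ℝ} (hp : ∀ t, |p t| ≤ M)
    (h : ∀ t, inventory y x p (t + 1) ∈ Set.Icc 0 (inventory y x p t)) (t : ℕ) :
    |discountedReward C β y x p t| ≤ (M * x + C x) * β ^ t := by
  have hM : 0 ≤ M := (abs_nonneg _).trans (hp 0)
  have h1 := inventory_mem_Icc hx h t
  have h2 := inventory_mem_Icc hx h (t + 1)
  have hC0 := hC.nonneg _ h2.1
  have hCx := hC.monotoneOn (Set.mem_Ici.2 h2.1) (Set.mem_Ici.2 hx) h2.2
  have h3 : |p t * (inventory y x p t - inventory y x p (t + 1))| ≤ M * x := by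
    rw [abs_mul]
    refine mul_le_mul (hp t) ?_ (abs_nonneg _) hM
    rw [abs_of_nonneg (sub_nonneg.2 (h t).2)]
    linarith [h1.2, h2.1]
  rw [discountedReward, abs_mul, abs_of_nonneg (pow_nonneg hβ.1.le t), mul_comm]
  refine mul_le_mul_of_nonneg_right ((abs_sub _ _).trans (add_le_add h3 ?_))
    (pow_nonneg hβ.1.le t)
  rwa [abs_of_nonneg hC0]

theorem summable_discountedReward (hβ : β ∈ Set.Ioo (0 : ℝ) 1) (hC : IsStorageCost C)
    (hx : 0 ≤ x) {p : ℕ → ℝ} (hp : ∀ t, |p t| ≤ M)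
    (h : ∀ t, inventory y x p (t + 1) ∈ Set.Icc 0 (inventory y x p t)) :
    Summable (discountedReward C β y x p) :=
  Summable.of_norm_bounded ((summable_geometric_of_lt_one hβ.1.le hβ.2).mul_left (M * x + C x))
    (abs_discountedReward_le hβ hC hx hp h)

theorem abs_totalReward_le (hβ : β ∈ Set.Ioo (0 : ℝ) 1) (hC : IsStorageCost C)
    (hx : 0 ≤ x) {p : ℕ → ℝ} (hp : ∀ t, |p t| ≤ M)
    (h : ∀ t, inventory y x p (t + 1) ∈ Set.Icc 0 (inventory y x p t)) :
    |totalReward C β y x p| ≤ (M * x + C x) * (1 - β)⁻¹ := by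
  rw [totalReward, ← Real.norm_eq_abs]
  exact tsum_of_norm_bounded ((hasSum_geometric_of_lt_one hβ.1.le hβ.2).mul_left (M * x + C x))
    (abs_discountedReward_le hβ hC hx hp h)

theorem exists_ae_abs_le {P : Measure ℝ} (hP : IsCompact P.support) : ∃ M : ℝ, ∀ᵐ q ∂P, |q| ≤ M := by
  obtain ⟨M, hM⟩ := hP.isBounded.exists_norm_le
  exact ⟨M, Filter.mem_of_superset Measure.support_mem_ae hM⟩

theorem ae_priceLaw_abs_le (hM : ∀ᵐ q ∂P, |q| ≤ M) :
    ∀ᵐ p ∂(priceLaw P), ∀ t, |p t| ≤ M :=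
  ae_all_iff.2 fun t =>
    (measurePreserving_eval_infinitePi (fun _ : ℕ => P) t).quasiMeasurePreserving.ae hM

theorem IsAdmissible.abs_objective_le (h : IsAdmissible P C β x y) (hM : ∀ᵐ q ∂P, |q| ≤ M)
    (hβ : β ∈ Set.Ioo (0 : ℝ) 1) (hC : IsStorageCost C) (hx : 0 ≤ x) :
    |objective P C β x y| ≤ (M * x + C x) * (1 - β)⁻¹ := by
  have := norm_integral_le_of_norm_le_const (μ := priceLaw P) (f := totalReward C β y x)
    (C := (M * x + C x) * (1 - β)⁻¹) (by
      filter_upwards [ae_priceLaw_abs_le hM, h.feasible] with p hp hf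
      exact abs_totalReward_le hβ hC hx hp hf)
  simpa [objective] using this

/-- By `sellDownTo_eq_min` the inventory is a running minimum involving only the rule at the fixed
`x`. Measurability in the price path then needs only measurability of the rule in the price. -/
theorem inventory_sellDownTo {P : Measure ℝ} (hC : IsStorageCost C) (hx : 0 ≤ x) (p : ℕ → ℝ) (t : ℕ) :
    inventory (fun _ => sellDownTo P C β) x p t ∈ Set.Icc 0 x ∧
    inventory (fun _ => sellDownTo P C β) x p (t + 1) =
      min (inventory (fun _ => sellDownTo P C β) x p t) (sellDownTo P C β x (p t)) := by
  have hmem : inventory (fun _ => sellDownTo P C β) x p t ∈ Set.Icc 0 x := by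
    induction t with
    | zero => exact ⟨hx, le_rfl⟩
    | succ t ih =>
      have := sellDownTo_mem_Icc (P := P) (β := β) hC ih.1 (p t)
      exact ⟨this.1, this.2.trans ih.2⟩
  exact ⟨hmem, sellDownTo_eq_min hC hmem.1 hmem.2 _⟩

theorem isAdmissible_sellDownTo (hM : ∀ᵐ q ∂P, |q| ≤ M) (hP : Integrable (fun q : ℝ => q) P)
    (hβ : β ∈ Set.Ioo (0 : ℝ) 1) (hC : IsStorageCost C) (hx : 0 ≤ x) :
    IsAdmissible P C β x fun _ => sellDownTo P C β := by
  have hfeas : ∀ p t, inventory (fun _ => sellDownTo P C β) x p (t + 1) ∈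
      Set.Icc 0 (inventory (fun _ => sellDownTo P C β) x p t) := fun p t =>
    sellDownTo_mem_Icc hC (inventory_sellDownTo hC hx p t).1.1 (p t)
  have hinv : ∀ t, Measurable fun p => inventory (fun _ => sellDownTo P C β) x p t := by
    intro t
    induction t with
    | zero => exact measurable_const
    | succ t ih =>
      simp only [(inventory_sellDownTo hC hx _ t).2]
      exact ih.min ((antitone_sellDownTo hP hβ hC hx).measurable.comp (measurable_pi_apply t))
  -- `C` is controlled only on `[0, ∞)`; truncating makes it monotone on `ℝ`, hence Borel.
  have hCm : Measurable fun z => C (max z 0) :=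
    Monotone.measurable fun a b hab => hC.monotoneOn (Set.mem_Ici.2 (le_max_right _ _))
      (Set.mem_Ici.2 (le_max_right _ _)) (max_le_max hab le_rfl)
  have hrew : ∀ t, Measurable fun p =>
      discountedReward C β (fun _ => sellDownTo P C β) x p t := by
    intro t
    have hCi : Measurable fun p => C (inventory (fun _ => sellDownTo P C β) x p (t + 1)) := by
      have := hCm.comp (hinv (t + 1))
      simpa only [Function.comp_def, max_eq_left (inventory_sellDownTo hC hx _ (t + 1)).1.1]
        using this
    exact (((measurable_pi_apply t).mul ((hinv t).sub (hinv (t + 1)))).sub hCi).const_mul _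
  refine ⟨fun _ z hz => (antitone_sellDownTo hP hβ hC hz).measurable,
    Filter.Eventually.of_forall hfeas, ?_, ?_⟩
  · filter_upwards [ae_priceLaw_abs_le hM] with p hp
    exact summable_discountedReward hβ hC hx hp (hfeas p)
  · refine Integrable.of_bound (Measurable.tsum hrew).aestronglyMeasurable
      ((M * x + C x) * (1 - β)⁻¹) ?_
    filter_upwards [ae_priceLaw_abs_le hM] with p hp
    exact abs_totalReward_le hβ hC hx hp (hfeas p)

end Bounds

/-! ### Verification by iterating the Bellman equation -/

section Verification

variable {P : Measure ℝ} [IsProbabilityMeasure P] {C : ℝ → ℝ} {β M X : ℝ}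

theorem exists_abs_objective_sub_valueFunction_le (hM : ∀ᵐ q ∂P, |q| ≤ M)
    (hP : Integrable (fun q : ℝ => q) P) (hβ : β ∈ Set.Ioo (0 : ℝ) 1) (hC : IsStorageCost C) :
    ∃ K, ∀ x ∈ Set.Icc 0 X, ∀ y, IsAdmissible P C β x y →
      |objective P C β x y - valueFunction P C β x| ≤ K := by
  obtain ⟨B, hB⟩ := isCompact_Icc.exists_bound_of_continuousOn (s := Set.Icc 0 X)
    (f := valueFunction P C β) (continuous_valueFunction hP hβ hC).continuousOn
  refine ⟨(M * X + C X) * (1 - β)⁻¹ + B, fun x hx y hy => (abs_sub _ _).trans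
    (add_le_add ((hy.abs_objective_le hM hβ hC hx.1).trans ?_) (hB x hx))⟩
  have hM0 : 0 ≤ M := by
    obtain ⟨q, hq⟩ := hM.exists
    exact (abs_nonneg q).trans hq
  have := hC.monotoneOn (Set.mem_Ici.2 hx.1) (Set.mem_Ici.2 (hx.1.trans hx.2)) hx.2
  have hβ1 : 0 ≤ (1 - β)⁻¹ := inv_nonneg.2 (sub_nonneg.2 hβ.2.le)
  gcongr
  exact hx.2

/-- Each use of the Bellman inequality multiplies the error by `β`. Quantifying over all `x` in `[0,
X]` and all `y` lets the induction hypothesis apply to the tail policy at the reduced inventory. -/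
theorem IsAdmissible.objective_le_add (hP : Integrable (fun q : ℝ => q) P)
    (hβ : β ∈ Set.Ioo (0 : ℝ) 1) (hC : IsStorageCost C) {K : ℝ}
    (hK : ∀ x ∈ Set.Icc 0 X, ∀ y, IsAdmissible P C β x y →
      |objective P C β x y - valueFunction P C β x| ≤ K) (n : ℕ) :
    ∀ x ∈ Set.Icc 0 X, ∀ y, IsAdmissible P C β x y →
      objective P C β x y ≤ valueFunction P C β x + β ^ n * K := by
  induction n with
  | zero =>
    intro x hx y hy
    linarith [(abs_le.1 (hK x hx y hy)).2]
  | succ n ih =>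
    intro x hx y hy
    obtain ⟨hint, heq⟩ := hy.integral_objective_tail hβ.1.ne'
    obtain ⟨hint', heq'⟩ := valueFunction_eq_integral hP hβ hC hx.1
    have hsum : valueFunction P C β x + β ^ (n + 1) * K = ∫ p, (-C 0 / (1 - β) +
        (∫ s in (0 : ℝ)..x, max p (criticalPrice P C β s)) + β ^ (n + 1) * K) ∂P := by
      rw [integral_add hint' (integrable_const _), ← heq']
      simp
    rw [heq, hsum]
    refine integral_mono_ae hint (hint'.add (integrable_const _)) ?_
    filter_upwards [hy.ae_mem_Icc, hy.ae_tail hβ.1.ne'] with a ha ht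
    have h1 := reward_add_valueFunction_le hP hβ hC ha a
    have h2 := mul_le_mul_of_nonneg_left
      (ih _ ⟨ha.1, ha.2.trans hx.2⟩ _ (ht ha.1)) hβ.1.le
    rw [mul_add, ← mul_assoc, ← pow_succ'] at h2
    linarith

theorem valueFunction_le_objective_sellDownTo_add (hM : ∀ᵐ q ∂P, |q| ≤ M)
    (hP : Integrable (fun q : ℝ => q) P)
    (hβ : β ∈ Set.Ioo (0 : ℝ) 1) (hC : IsStorageCost C) {K : ℝ}
    (hK : ∀ x ∈ Set.Icc 0 X, ∀ y, IsAdmissible P C β x y →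
      |objective P C β x y - valueFunction P C β x| ≤ K) (n : ℕ) :
    ∀ x ∈ Set.Icc 0 X,
      valueFunction P C β x ≤ objective P C β x (fun _ => sellDownTo P C β) + β ^ n * K := by
  induction n with
  | zero =>
    intro x hx
    linarith [(abs_le.1 (hK x hx _ (isAdmissible_sellDownTo hM hP hβ hC hx.1))).1]
  | succ n ih =>
    intro x hx
    obtain ⟨hint, heq⟩ :=
      (isAdmissible_sellDownTo hM hP hβ hC hx.1).integral_objective_tail hβ.1.ne'
    obtain ⟨hint', heq'⟩ := valueFunction_eq_integral hP hβ hC hx.1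
    have hsum := integral_add hint (integrable_const (β ^ (n + 1) * K))
    rw [← heq, integral_const, probReal_univ, one_smul] at hsum
    rw [heq', ← hsum]
    refine integral_mono hint' (hint.add (integrable_const _)) fun a => ?_
    have ha := sellDownTo_mem_Icc (P := P) (β := β) hC hx.1 a
    have h2 := mul_le_mul_of_nonneg_left (ih _ ⟨ha.1, ha.2.trans hx.2⟩) hβ.1.le
    rw [mul_add, ← mul_assoc, ← pow_succ'] at h2
    simp only [← reward_add_valueFunction_sellDownTo hP hβ hC hx.1 a]
    -- A stationary policy is definitionally its own tail, so the induction hypothesis concerns the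
    -- same policy.
    change _ ≤ a * (x - sellDownTo P C β x a) - C (sellDownTo P C β x a) + β *
      objective P C β (sellDownTo P C β x a) (fun _ => sellDownTo P C β) + _
    linarith

theorem le_of_forall_le_add_pow_mul {a b K : ℝ} (hβ : β ∈ Set.Ioo (0 : ℝ) 1)
    (h : ∀ n : ℕ, a ≤ b + β ^ n * K) : a ≤ b := by
  refine ge_of_tendsto' (x := Filter.atTop) (f := fun n : ℕ => b + β ^ n * K) ?_ h
  simpa using ((tendsto_pow_atTop_nhds_zero_of_lt_one hβ.1.le hβ.2).mul_const K).const_add b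

theorem isOptimal_sellDownTo (hM : ∀ᵐ q ∂P, |q| ≤ M) (hβ : β ∈ Set.Ioo (0 : ℝ) 1)
    (hC : IsStorageCost C) {x : ℝ} (hx : 0 ≤ x) :
    IsOptimal P C β x fun _ => sellDownTo P C β := by
  have hP : Integrable (fun q : ℝ => q) P :=
    Integrable.of_bound measurable_id.aestronglyMeasurable M hM
  obtain ⟨K, hK⟩ := exists_abs_objective_sub_valueFunction_le (X := x) hM hP hβ hC
  refine ⟨isAdmissible_sellDownTo hM hP hβ hC hx, fun y hy => ?_⟩
  exact (le_of_forall_le_add_pow_mul hβ fun n =>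
      IsAdmissible.objective_le_add hP hβ hC hK n x ⟨hx, le_rfl⟩ y hy).trans
    (le_of_forall_le_add_pow_mul hβ fun n =>
      valueFunction_le_objective_sellDownTo_add hM hP hβ hC hK n x ⟨hx, le_rfl⟩)

end Verification

end ROSP

theorem proposition2 (P : MeasureTheory.Measure ℝ) [MeasureTheory.IsProbabilityMeasure P]
    (hP : IsCompact P.support) (C : ℝ → ℝ) (hC : ROSP.IsStorageCost C)
    (β : ℝ) (hβ : β ∈ Set.Ioo (0 : ℝ) 1) :
    (∀ x, 0 ≤ x → ∀ p, ROSP.sellDownTo P C β x p ∈ Set.Icc 0 x) ∧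
      ∀ x₁, 0 ≤ x₁ → ROSP.IsOptimal P C β x₁ (fun _ => ROSP.sellDownTo P C β) := by
  obtain ⟨M, hM⟩ := ROSP.exists_ae_abs_le hP
  exact ⟨fun x hx p => ROSP.sellDownTo_mem_Icc hC hx p,
    fun x hx => ROSP.isOptimal_sellDownTo hM hβ hC hx⟩
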